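/- Let $N\ge 1$, $S\ge 0$. For $i=1,\dots,N$ let $X_i\subset\mathbb R^{n_i}$ be non-empty, convex and compact, let $f_i:\mathbb R^{n_i}\to\mathbb R$ be convex and let $\mathbf g_i:\mathbb R^{n_i}\to\mathbb R^S$ have convex components. Consider the coupled problem $$\min_{\mathbf x_1,\dots,\mathbf x_N}\ \sum_{i=1}^N f_i(\mathbf x_i)\quad\text{subject to}\quad \sum_{i=1}^N\mathbf g_i(\mathbf x_i)\le\mathbf 0,\qquad \mathbf x_i\in X_i\ (i=1,\dots,N),\tag{P}$$ with optimal cost $f^\star$, inequalities between vectors being componentwise. Assume Slater's condition: there are $\bar{\mathbf x}_i\in X_i$ with $\sum_{i}\mathbf g_i(\bar{\mathbf x}_i)<\mathbf 0$. A Lagrange multiplier of a convex program is a non-negative vector for which the infimum of the Lagrangian (over the constraints that are not dualized) equals the optimal cost of the program. Let $\boldsymbol\mu^\star$ be a Lagrange multiplier of (P) associated to $\sum_i\mathbf g_i(\mathbf x_i)\le\mathbf 0$, and let $M>\|\boldsymbol\mu^\star\|_1$. Let $\mathcal G_u$ be a connected undirected graph on $\{1,\dots,N\}$. For each edge $e$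 of $\mathcal G_u$ and each $t\ge 0$ let $\nu_e^t\in\{0,1\}$ be the indicator of the event that $e$ is active at time $t$; it is a Bernoulli variable with $\mathbb P(\nu_e^t=1)=\sigma_e\in(0,1]$, the same for all $t$, and the variables $\nu_e^t$, over all edges and all times, are independent. Let $\mathcal N_i^t$ be the set of $j$ such that $\{i,j\}$ is an edge of $\mathcal G_u$ that is active at time $t$. Let $\alpha^t\ge 0$ with $\sum_t\alpha^t=\infty$ and $\sum_t(\alpha^t)^2<\infty$. The distributed algorithm starts from (deterministic) allocations $\mathbf y_i^0\in\mathbb R^S$ with $\sum_i\mathbf y_i^0=\mathbf 0$. At each iteration $t=0,1,2,\dots$, each agent $i$ computes an optimal solution $(\mathbf x_i^t,\rho_i^t)$ of $$\min_{\mathbf x_i,\rho_i}\ f_i(\mathbf x_i)+M\rho_i\quad\text{subject to}\quad \mathbf g_i(\mathbf x_i)\le\mathbf y_i^t+\rho_i\mathbf 1,\quad \mathbf x_i\in X_i,\ \rho_i\ge 0,$$ and a Lagrange multiplier $\boldsymbol\mu_i^t$ of this problem associated to its first constraint, and then sets $$\mathbf y_i^{t+1}=\mathbf y_i^t+\alpha^t\sum_{j\in\mathcal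 N_i^t}\big(\boldsymbol\mu_i^t-\boldsymbol\mu_j^t\big).$$ If these solutions are not unique, any of them may be chosen, as long as the choice of the multipliers $\boldsymbol\mu_i^t$ does not anticipate the activations: it depends (measurably) only on the activations at times $s<t$ and, possibly, on auxiliary randomness that is independent of all the activations. Then, almost surely, (i) $\sum_{i=1}^N\big(f_i(\mathbf x_i^t)+M\rho_i^t\big)\to f^\star$ as $t\to\infty$; (ii) every limit point of $\{(\mathbf x_1^t,\dots,\mathbf x_N^t)\}_{t\ge 0}$ is an optimal (in particular feasible) solution of (P). -/

import Mathlib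

open MeasureTheory ProbabilityTheory Filter Topology

noncomputable section

/-- The optimization problem: minimize `cost z` subject to `z ∈ domain` and to the `S` dualized
inequality constraints `constr z ≤ 0` (componentwise). -/
structure Program (E : Type*) (S : ℕ) where
  domain : Set E
  cost : E → ℝ
  constr : E → Fin S → ℝ

namespace Program

variable {E : Type*} {S : ℕ}

/-- The feasible set. -/
def feasible (Q : Program E S) : Set E := {z | z ∈ Q.domain ∧ ∀ s, Q.constr z s ≤ 0}

/-- The optimal cost, i.e. the infimum of the cost over the feasible set. -/
def optimalCost (Q : Program E S) : ℝ := sInf (Q.cost '' Q.feasible)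

/-- Optimal solutions: feasible points of least cost. -/
def IsOptimal (Q : Program E S) (z : E) : Prop :=
  z ∈ Q.feasible ∧ ∀ w ∈ Q.feasible, Q.cost z ≤ Q.cost w

/-- The Lagrangian in which only the constraint `constr z ≤ 0` is dualized. -/
def lagrangian (Q : Program E S) (m : Fin S → ℝ) (z : E) : ℝ :=
  Q.cost z + ∑ s, m s * Q.constr z s

/-- `m` is an (optimal) Lagrange multiplier: `m ≥ 0`, and the infimum of the Lagrangian over the
domain equals the optimal cost. -/
def IsLagrangeMultiplier (Q : Program E S) (m : Fin S → ℝ) : Prop :=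
  (∀ s, 0 ≤ m s) ∧ IsGLB (Q.lagrangian m '' Q.domain) Q.optimalCost

/-- Primal-dual solutions: an optimal solution together with a Lagrange multiplier. -/
def IsPrimalDualSolution (Q : Program E S) (z : E) (m : Fin S → ℝ) : Prop :=
  Q.IsOptimal z ∧ Q.IsLagrangeMultiplier m

end Program

/-- The data of a constraint-coupled problem with `N` agents and `S` coupling constraints: agent `i`
has a decision variable in `ℝ^(n i)`, a cost `f i`, a contribution `g i` to the coupling constraints
and a local constraint set `X i`. -/
structure CoupledData (N S : ℕ) where
  n : Fin N → ℕ
  f : (i : Fin N) → EuclideanSpace ℝ (Fin (n i)) → ℝ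
  g : (i : Fin N) → EuclideanSpace ℝ (Fin (n i)) → Fin S → ℝ
  X : (i : Fin N) → Set (EuclideanSpace ℝ (Fin (n i)))

namespace CoupledData

variable {N S : ℕ}

/-- The space `ℝ^(n i)` of the decision variable of agent `i`. -/
abbrev Var (D : CoupledData N S) (i : Fin N) : Type := EuclideanSpace ℝ (Fin (D.n i))

/-- The coupled problem: minimize `∑ i, f i (x i)` subject to `∑ i, g i (x i) ≤ 0` and
`x i ∈ X i` for every `i`. -/
def coupled (D : CoupledData N S) : Program ((i : Fin N) → D.Var i) S where
  domain := {x | ∀ i, x i ∈ D.X i}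
  cost := fun x => ∑ i, D.f i (x i)
  constr := fun x s => ∑ i, D.g i (x i) s

/-- The local problem of agent `i` for the allocation `yi`: minimize `f i x + M * r` over pairs
`(x, r)` subject to `g i x ≤ yi + r 1`, `x ∈ X i` and `r ≥ 0`; only the first constraint is
dualized. -/
def localProblem (D : CoupledData N S) (M : ℝ) (i : Fin N) (yi : Fin S → ℝ) :
    Program (D.Var i × ℝ) S where
  domain := {z | z.1 ∈ D.X i ∧ 0 ≤ z.2}
  cost := fun z => D.f i z.1 + M * z.2
  constr := fun z s => D.g i z.1 s - (yi s + z.2)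

/-- Every local set is non-empty, convex and compact; costs and constraints are convex. -/
structure IsConvexCompact (D : CoupledData N S) : Prop where
  X_nonempty : ∀ i, (D.X i).Nonempty
  X_convex : ∀ i, Convex ℝ (D.X i)
  X_compact : ∀ i, IsCompact (D.X i)
  f_convex : ∀ i, ConvexOn ℝ Set.univ (D.f i)
  g_convex : ∀ i s, ConvexOn ℝ Set.univ (fun x => D.g i x s)

/-- Slater's constraint qualification. -/
def Slater (D : CoupledData N S) : Prop :=
  ∃ x : (i : Fin N) → D.Var i, (∀ i, x i ∈ D.X i) ∧ ∀ s, ∑ i, D.g i (x i) s < 0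

end CoupledData

/-- Step-sizes `α t ≥ 0` with `∑ α t = ∞` and `∑ (α t)^2 < ∞`. -/
structure IsStepSize (α : ℕ → ℝ) : Prop where
  nonneg : ∀ t, 0 ≤ α t
  sum_eq_top : Tendsto (fun T => ∑ t ∈ Finset.range T, α t) atTop atTop
  sum_sq_lt_top : Summable (fun t => α t ^ 2)

/-- The communication graph obtained from the underlying graph `G` by keeping exactly the edges
whose indicator is `true`. -/
def activeGraph {N : ℕ} (G : SimpleGraph (Fin N)) (a : G.edgeSet → Bool) :
    SimpleGraph (Fin N) where
  Adj i j := ∃ h : s(i, j) ∈ G.edgeSet, a ⟨s(i, j), h⟩ = true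
  symm := ⟨fun i j ⟨h, ha⟩ => by
    have e : s(i, j) = s(j, i) := Sym2.eq_swap
    refine ⟨e ▸ h, ?_⟩
    have e' : (⟨s(j, i), e ▸ h⟩ : G.edgeSet) = ⟨s(i, j), h⟩ := Subtype.ext e.symm
    rw [e']
    exact ha⟩
  loopless := ⟨fun i ⟨h, _⟩ => G.loopless.irrefl i h⟩

/-- The random activation model on the underlying graph `G`: `ν t e` is the indicator of the event
that the undirected edge `e` is active at time `t`. It is a Bernoulli variable of parameter
`σ e ∈ (0, 1]`, the same for all `t`, and all these variables, over edges and over times, are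
independent. -/
structure IsActivationModel {N : ℕ} (G : SimpleGraph (Fin N)) {Ω : Type*} [MeasurableSpace Ω]
    (P : Measure Ω) (σ : G.edgeSet → ℝ) (ν : ℕ → G.edgeSet → Ω → Bool) : Prop where
  σ_pos : ∀ e, 0 < σ e
  σ_le_one : ∀ e, σ e ≤ 1
  measurable : ∀ t e, Measurable (ν t e)
  prob_active : ∀ t e, P.real {ω | ν t e ω = true} = σ e
  indep : iIndepFun (fun (p : ℕ × G.edgeSet) => ν p.1 p.2) P

/-- The σ-algebra generated by all the activations. -/
@[reducible] def activations {ι Ω : Type*} (ν : ℕ → ι → Ω → Bool) : MeasurableSpace Ω :=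
  ⨆ (t : ℕ) (e : ι), MeasurableSpace.comap (ν t e) inferInstance

/-- The information available when the local problems of iteration `t` are solved: the activations
at the times `s < t`, and a σ-algebra `𝒰` that carries internal randomness of the solvers
(`𝒰 = ⊥` for solvers without such randomness). -/
@[reducible] def information {ι Ω : Type*} (𝒰 : MeasurableSpace Ω) (ν : ℕ → ι → Ω → Bool) (t : ℕ) :
    MeasurableSpace Ω :=
  𝒰 ⊔ ⨆ (s : ℕ) (_ : s < t) (e : ι), MeasurableSpace.comap (ν s e) inferInstance

open Classical in
/-- `(x, ρ, m, y)` is generated by the distributed algorithm along the activation pattern `a`, with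
initial allocations `y0`, step-sizes `α` and parameter `M`: at every iteration `t` each agent
computes a primal-dual solution `((x t i, ρ t i), m t i)` of its local problem for the allocation
`y t i`, and updates the allocation with the multipliers of its neighbours in the active graph. -/
structure IsGenerated {N S : ℕ} (D : CoupledData N S) (G : SimpleGraph (Fin N)) (M : ℝ)
    (α : ℕ → ℝ) (y0 : Fin N → Fin S → ℝ) (a : ℕ → G.edgeSet → Bool)
    (x : ℕ → (i : Fin N) → D.Var i) (ρ : ℕ → Fin N → ℝ)
    (m y : ℕ → Fin N → Fin S → ℝ) : Prop where
  init : y 0 = y0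
  solve : ∀ t i, (D.localProblem M i (y t i)).IsPrimalDualSolution (x t i, ρ t i) (m t i)
  update : ∀ t i, y (t + 1) i =
    y t i + α t • ∑ j with (activeGraph G (a t)).Adj i j, (m t i - m t j)

end

/-! Let `p_i(y_i)` be the optimal cost of the penalized local problem. Since `M > ‖μ⋆‖₁`, the
penalty is exact: over allocations with zero sum, `∑ p_i(y_i)` has minimum `f⋆`, and its excess over
`f⋆` is at least `(M - ‖μ⋆‖₁) ∑ ρ_i` (`optimalCost_add_le`). The multipliers are bounded by `M`, and
their negatives are subgradients of the `p_i` (`cost_add_le`).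

Each `y_i` is `y0_i` plus the divergence of a flow on the edges, and the algorithm is a randomized
subgradient method in the flow variables, in which an activation moves only its own edge. By
connectivity some reference flow leads from `y0` to an optimal allocation. Measure the squared
distance to it with weight `1/σ_e` on edge `e`. The activations at time `t` are independent of the
past, so in expectation the weights cancel the activation probabilities, and the energy decreases by
`4 α^t E[d^t]` up to `O((α^t)²)`, where the pairing `d^t` dominates the gap `∑ p_i(y_i^t) - f⋆ ≥ 0`.
Telescoping gives `∑ α^t d^t < ∞` almost surely (`ae_summable_pairing`).

The rest is deterministic. The gap is summable against `α` and changes by `O(α^t)` per step, so it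
tends to zero (`IsStepSize.tendsto_zero`). Exactness then forces `∑ ρ_i → 0`, and continuity on
compact sets makes limit points optimal. -/

noncomputable section

/-! ### Sequences weighted by step-sizes. -/

/-- A nonnegative sequence that is summable against non-summable, square-summable weights, and whose
increments are dominated by the weights, tends to zero. -/
theorem IsStepSize.tendsto_zero {α a : ℕ → ℝ} (hα : IsStepSize α) {C : ℝ} (ha : ∀ t, 0 ≤ a t)
    (hsum : Summable fun t => α t * a t) (hinc : ∀ t, |a (t + 1) - a t| ≤ C * α t) :
    Tendsto a atTop (𝓝 0) := by
  -- The increments of `a` need not be summable, but those of `a²` are: they carry an extra factor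
  -- of order `a t + α t`, which turns the bound `α t` into `α t * a t` and `α t ^ 2`.
  have hcauchy : CauchySeq fun t => a t ^ 2 := by
    refine cauchySeq_of_dist_le_of_summable (fun t => 2 * |C| * (α t * a t) + C ^ 2 * α t ^ 2)
      (fun t => ?_) ((hsum.mul_left _).add (hα.sum_sq_lt_top.mul_left _))
    rw [dist_comm, Real.dist_eq]
    have h0 := hα.nonneg t
    have h1 : |a (t + 1) - a t| ≤ |C| * α t :=
      (hinc t).trans (mul_le_mul_of_nonneg_right (le_abs_self C) h0)
    have h2 : a (t + 1) + a t ≤ 2 * a t + |C| * α t := by linarith [(abs_le.mp h1).2]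
    have h3 : a (t + 1) ^ 2 - a t ^ 2 = (a (t + 1) - a t) * (a (t + 1) + a t) := by ring
    rw [Nat.succ_eq_add_one, h3, abs_mul, abs_of_nonneg (add_nonneg (ha (t + 1)) (ha t))]
    calc _ ≤ |C| * α t * (2 * a t + |C| * α t) :=
          mul_le_mul h1 h2 (add_nonneg (ha _) (ha _)) (by positivity)
      _ = _ := by rw [← sq_abs C]; ring
  obtain ⟨l, hl⟩ := cauchySeq_tendsto_of_complete hcauchy
  have hroot : Tendsto a atTop (𝓝 √l) := by
    have := hl.sqrt
    simpa only [Real.sqrt_sq (ha _)] using this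
  rcases (Real.sqrt_nonneg l).eq_or_lt with h | h
  · rwa [← h] at hroot
  exfalso
  have hev : ∀ᶠ t in atTop, √l / 2 ≤ a t :=
    (hroot.eventually (lt_mem_nhds (half_lt_self h))).mono fun t ht => ht.le
  -- A positive limit of `a` would bound `α` by a multiple of `α * a`.
  have hαsum : Summable α := by
    have hs : Summable fun t => (2 / √l) * (α t * a t) := hsum.mul_left _
    refine Summable.of_norm_bounded_eventually_nat hs (hev.mono fun t ht => ?_)
    rw [Real.norm_of_nonneg (hα.nonneg t)]
    calc α t = (2 / √l) * (α t * (√l / 2)) := by field_simp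
      _ ≤ _ := by
        have := hα.nonneg t
        gcongr
  exact not_tendsto_nhds_of_tendsto_atTop hα.sum_eq_top _ hαsum.hasSum.tendsto_sum_nat

/-! ### Duality and exact penalization. -/

namespace Program

variable {E : Type*} {S : ℕ} {Q : Program E S} {z : E}

theorem IsOptimal.optimalCost_eq (h : Q.IsOptimal z) : Q.optimalCost = Q.cost z := by
  refine IsLeast.csInf_eq ⟨⟨z, h.1, rfl⟩, ?_⟩
  rintro _ ⟨w, hw, rfl⟩
  exact h.2 w hw

theorem IsLagrangeMultiplier.optimalCost_le {m : Fin S → ℝ} (h : Q.IsLagrangeMultiplier m)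
    (hz : z ∈ Q.domain) : Q.optimalCost ≤ Q.lagrangian m z :=
  h.2.1 ⟨z, hz, rfl⟩

end Program

namespace CoupledData

variable {N S : ℕ} {D : CoupledData N S} {M : ℝ}

/-- Multipliers of the penalized local problem are bounded by the penalty. -/
theorem sum_multiplier_le {i : Fin N} {yi : Fin S → ℝ} {z : D.Var i × ℝ} {m : Fin S → ℝ}
    (h : (D.localProblem M i yi).IsPrimalDualSolution z m) : ∑ s, m s ≤ M := by
  obtain ⟨⟨⟨⟨hz, -⟩, -⟩, -⟩, hm⟩ := h
  by_contra! hlt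
  set c := D.f i z.1 + ∑ s, m s * (D.g i z.1 s - yi s) with hc
  set v := (D.localProblem M i yi).optimalCost with hv
  -- The Lagrangian is affine in the relaxation `r`, with slope `M - ∑ m`; a negative slope would
  -- make it unbounded below as `r` grows.
  have key : ∀ r : ℝ, 0 ≤ r → v ≤ c - (∑ s, m s - M) * r := by
    intro r hr
    have := hm.optimalCost_le (z := (z.1, r)) ⟨hz, hr⟩
    refine this.trans_eq ?_
    simp only [Program.lagrangian, localProblem, hc]
    have : ∀ s, m s * (D.g i z.1 s - (yi s + r)) = m s * (D.g i z.1 s - yi s) - m s * r :=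
      fun s => by ring
    simp only [this, Finset.sum_sub_distrib, ← Finset.sum_mul]
    ring
  have hpos : 0 < ∑ s, m s - M := by linarith
  have h1 := key ((|c - v| + 1) / (∑ s, m s - M)) (by positivity)
  rw [mul_div_cancel₀ _ hpos.ne'] at h1
  linarith [le_abs_self (c - v)]

theorem multiplier_le {i : Fin N} {yi : Fin S → ℝ} {z : D.Var i × ℝ} {m : Fin S → ℝ}
    (h : (D.localProblem M i yi).IsPrimalDualSolution z m) (s : Fin S) : m s ≤ M :=
  (Finset.single_le_sum (fun s _ => h.2.1 s) (Finset.mem_univ s)).trans (sum_multiplier_le h)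

/-- The negative of a multiplier is a subgradient of the local optimal cost. -/
theorem cost_add_le {i : Fin N} {yi yi' : Fin S → ℝ} {z w : D.Var i × ℝ} {m : Fin S → ℝ}
    (h : (D.localProblem M i yi).IsPrimalDualSolution z m)
    (hw : w ∈ (D.localProblem M i yi').feasible) :
    D.f i z.1 + M * z.2 + ∑ s, m s * (yi s - yi' s) ≤ D.f i w.1 + M * w.2 := by
  have h1 := h.2.optimalCost_le (z := w) hw.1
  rw [h.1.optimalCost_eq] at h1
  have h2 : ∑ s, m s * (D.g i w.1 s - (yi' s + w.2)) ≤ 0 :=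
    Finset.sum_nonpos fun s _ => mul_nonpos_of_nonneg_of_nonpos (h.2.1 s) (hw.2 s)
  have h3 : ∑ s, m s * (D.g i w.1 s - (yi s + w.2)) =
      ∑ s, m s * (D.g i w.1 s - (yi' s + w.2)) - ∑ s, m s * (yi s - yi' s) := by
    rw [← Finset.sum_sub_distrib]
    exact Finset.sum_congr rfl fun s _ => by ring
  simp only [Program.lagrangian, localProblem] at h1
  linarith

/-- The violation of the coupling constraint is at most the total relaxation. -/
theorem constr_le_sum {y : Fin N → Fin S → ℝ} (hy : ∑ i, y i = 0) {x : (i : Fin N) → D.Var i}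
    {ρ : Fin N → ℝ} (hx : ∀ i, (x i, ρ i) ∈ (D.localProblem M i (y i)).feasible) (s : Fin S) :
    D.coupled.constr x s ≤ ∑ i, ρ i := by
  have h3 : ∑ i, y i s = 0 := by simpa using congrFun hy s
  calc ∑ i, D.g i (x i) s ≤ ∑ i, (y i s + ρ i) :=
        Finset.sum_le_sum fun i _ => by
          have := (hx i).2 s
          simp only [localProblem] at this
          linarith
    _ = ∑ i, ρ i := by rw [Finset.sum_add_distrib, h3, zero_add]

/-- Exactness of the penalty: the penalized cost exceeds the optimal cost by at least a multiple of
the total relaxation. -/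
theorem optimalCost_add_le {mstar : Fin S → ℝ} (hm : D.coupled.IsLagrangeMultiplier mstar)
    {y : Fin N → Fin S → ℝ} (hy : ∑ i, y i = 0) {x : (i : Fin N) → D.Var i} {ρ : Fin N → ℝ}
    (hx : ∀ i, (x i, ρ i) ∈ (D.localProblem M i (y i)).feasible) :
    D.coupled.optimalCost + (M - ∑ s, mstar s) * ∑ i, ρ i ≤ ∑ i, (D.f i (x i) + M * ρ i) := by
  have h1 := hm.optimalCost_le (z := x) fun i => (hx i).1.1
  have h2 := constr_le_sum hy hx
  -- At the price `mstar`, a violation of at most `∑ ρ` lowers the cost by at most `‖mstar‖₁ ∑ ρ`,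
  -- while the penalty charges `M ∑ ρ`.
  have h4 : ∑ s, mstar s * D.coupled.constr x s ≤ (∑ s, mstar s) * ∑ i, ρ i := by
    rw [Finset.sum_mul]
    exact Finset.sum_le_sum fun s _ => mul_le_mul_of_nonneg_left (h2 s) (hm.1 s)
  simp only [Program.lagrangian] at h1
  have h5 : D.coupled.cost x = ∑ i, D.f i (x i) := rfl
  rw [Finset.sum_add_distrib, ← Finset.mul_sum, ← h5]
  linarith

theorem IsConvexCompact.continuous_f (hD : D.IsConvexCompact) (i : Fin N) : Continuous (D.f i) :=
  (hD.f_convex i).locallyLipschitz.continuous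

theorem IsConvexCompact.continuous_g (hD : D.IsConvexCompact) (i : Fin N) (s : Fin S) :
    Continuous fun x => D.g i x s :=
  (hD.g_convex i s).locallyLipschitz.continuous

theorem IsConvexCompact.continuous_cost (hD : D.IsConvexCompact) : Continuous D.coupled.cost := by
  change Continuous fun x : (i : Fin N) → D.Var i => ∑ i, D.f i (x i)
  exact continuous_finsetSum _ fun i _ => (hD.continuous_f i).comp (continuous_apply i)

theorem IsConvexCompact.continuous_constr (hD : D.IsConvexCompact) (s : Fin S) :
    Continuous fun x => D.coupled.constr x s := by
  change Continuous fun x : (i : Fin N) → D.Var i => ∑ i, D.g i (x i) s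
  exact continuous_finsetSum _ fun i _ => (hD.continuous_g i s).comp (continuous_apply i)

theorem IsConvexCompact.isClosed_feasible (hD : D.IsConvexCompact) :
    IsClosed D.coupled.feasible := by
  have h : D.coupled.feasible =
      Set.pi Set.univ D.X ∩ ⋂ s, {x | D.coupled.constr x s ≤ 0} := by
    ext x
    simp [Program.feasible, coupled]
  rw [h]
  exact (isClosed_set_pi fun i _ => (hD.X_compact i).isClosed).inter
    (isClosed_iInter fun s => isClosed_le (hD.continuous_constr s) continuous_const)

theorem IsConvexCompact.exists_isOptimal (hD : D.IsConvexCompact) (hS : D.Slater) :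
    ∃ x, D.coupled.IsOptimal x := by
  obtain ⟨x₀, hx₀, hx₀'⟩ := hS
  have hcomp : IsCompact D.coupled.feasible :=
    (isCompact_univ_pi hD.X_compact).of_isClosed_subset hD.isClosed_feasible
      fun x hx i _ => hx.1 i
  obtain ⟨x, hx, hmin⟩ := hcomp.exists_isMinOn ⟨x₀, hx₀, fun s => (hx₀' s).le⟩
    hD.continuous_cost.continuousOn
  exact ⟨x, hx, fun w hw => hmin hw⟩

/-- An optimal solution of the coupled problem is locally feasible, without relaxation, for a
suitable allocation of the resources. -/
theorem exists_allocation [NeZero N] {x : (i : Fin N) → D.Var i} (hx : x ∈ D.coupled.feasible) :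
    ∃ y : Fin N → Fin S → ℝ, ∑ i, y i = 0 ∧
      ∀ i, (x i, (0 : ℝ)) ∈ (D.localProblem M i (y i)).feasible := by
  have hN : (0 : ℝ) < N := Nat.cast_pos.mpr (Nat.pos_of_ne_zero (NeZero.ne N))
  -- Each agent receives what it uses plus an equal share of the total slack.
  refine ⟨fun i s => D.g i (x i) s - D.coupled.constr x s / N, ?_, fun i => ⟨⟨hx.1 i, le_rfl⟩, ?_⟩⟩
  · ext s
    simp only [Finset.sum_apply, Finset.sum_sub_distrib, Finset.sum_const, Finset.card_univ,
      Fintype.card_fin, nsmul_eq_mul, Pi.zero_apply]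
    rw [mul_div_cancel₀ _ hN.ne']
    exact sub_self _
  · intro s
    have := div_nonpos_of_nonpos_of_nonneg (hx.2 s) hN.le
    simp only [localProblem]
    linarith

end CoupledData

/-! ### Flows on graphs. -/

/-- An antisymmetric flow supported on the edges of a graph. -/
structure IsFlow {V : Type*} (G : SimpleGraph V) (z : V → V → ℝ) : Prop where
  antisymm : ∀ i j, z j i = -z i j
  support : ∀ i j, ¬ G.Adj i j → z i j = 0

namespace IsFlow

variable {V : Type*} {G : SimpleGraph V} {z z' : V → V → ℝ}

theorem zero : IsFlow G fun _ _ => 0 := ⟨by simp, by simp⟩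

theorem add (h : IsFlow G z) (h' : IsFlow G z') : IsFlow G fun i j => z i j + z' i j where
  antisymm i j := by rw [h.antisymm, h'.antisymm]; ring
  support i j hij := by rw [h.support i j hij, h'.support i j hij, add_zero]

theorem sub (h : IsFlow G z) (h' : IsFlow G z') : IsFlow G fun i j => z i j - z' i j where
  antisymm i j := by rw [h.antisymm, h'.antisymm]; ring
  support i j hij := by rw [h.support i j hij, h'.support i j hij, sub_zero]

theorem const_mul (h : IsFlow G z) (c : ℝ) : IsFlow G fun i j => c * z i j where
  antisymm i j := by rw [h.antisymm]; ring
  support i j hij := by rw [h.support i j hij, mul_zero]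

theorem sum {ι : Type*} {s : Finset ι} {w : ι → V → V → ℝ} (h : ∀ k ∈ s, IsFlow G (w k)) :
    IsFlow G fun i j => ∑ k ∈ s, w k i j where
  antisymm i j := by
    rw [← Finset.sum_neg_distrib]
    exact Finset.sum_congr rfl fun k hk => (h k hk).antisymm i j
  support i j hij := Finset.sum_eq_zero fun k hk => (h k hk).support i j hij

/-- Summation by parts. -/
theorem sum_mul_sub [Fintype V] (h : IsFlow G z) (p : V → ℝ) :
    ∑ i, ∑ j, z i j * (p i - p j) = 2 * ∑ i, p i * ∑ j, z i j := by
  have h1 : ∑ i, ∑ j, z i j * p j = -∑ i, p i * ∑ j, z i j := by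
    rw [Finset.sum_comm, ← Finset.sum_neg_distrib]
    refine Finset.sum_congr rfl fun j _ => ?_
    rw [Finset.mul_sum, ← Finset.sum_neg_distrib]
    refine Finset.sum_congr rfl fun i _ => ?_
    rw [h.antisymm j i]
    ring
  have h2 : ∑ i, ∑ j, z i j * p i = ∑ i, p i * ∑ j, z i j :=
    Finset.sum_congr rfl fun i _ => by rw [Finset.mul_sum]; simp only [mul_comm]
  simp only [mul_sub, Finset.sum_sub_distrib, h1, h2]
  ring

/-- The divergence of a flow sums to zero. -/
theorem sum_sum_eq_zero [Fintype V] (h : IsFlow G z) : ∑ i, ∑ j, z i j = 0 := by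
  simpa using h.sum_mul_sub fun _ => 1

/-- One unit is sent along each step of the walk, and the divergences telescope. Repeated edges
simply accumulate, so no path is needed. -/
theorem exists_of_walk [Fintype V] [DecidableEq V] {u v : V} (p : G.Walk u v) :
    ∃ z, IsFlow G z ∧
      ∀ i, ∑ j, z i j = (Pi.single u (1 : ℝ) : V → ℝ) i - (Pi.single v (1 : ℝ) : V → ℝ) i := by
  induction p with
  | nil => exact ⟨fun _ _ => 0, zero, by simp⟩
  | @cons u v w hadj p ih =>
    obtain ⟨z, hz, hdiv⟩ := ih
    have huv : u ≠ v := hadj.ne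
    refine ⟨fun i j => ((if i = u ∧ j = v then 1 else 0) - (if i = v ∧ j = u then 1 else 0)) +
      z i j, IsFlow.add ⟨fun i j => ?_, fun i j hij => ?_⟩ hz, fun i => ?_⟩
    · simp only [and_comm]; ring
    · have h1 : ¬(i = u ∧ j = v) := by rintro ⟨rfl, rfl⟩; exact hij hadj
      have h2 : ¬(i = v ∧ j = u) := by rintro ⟨rfl, rfl⟩; exact hij hadj.symm
      rw [if_neg h1, if_neg h2, sub_zero]
    · rw [Finset.sum_add_distrib, hdiv, Finset.sum_sub_distrib]
      have h1 : ∀ a b : V, (∑ j, if i = a ∧ j = b then (1 : ℝ) else 0) =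
          (Pi.single a (1 : ℝ) : V → ℝ) i := by
        intro a b
        by_cases hi : i = a <;> simp [hi]
      rw [h1, h1]
      ring

/-- On a connected graph every vector with zero sum is the divergence of a flow. -/
theorem exists_of_sum_eq_zero [Fintype V] (hG : G.Connected) {b : V → ℝ} (hb : ∑ i, b i = 0) :
    ∃ z, IsFlow G z ∧ ∀ i, ∑ j, z i j = b i := by
  classical
  obtain ⟨v⟩ := hG.nonempty
  choose z hz hdiv using fun u => exists_of_walk (hG.preconnected u v).some
  -- Every `b u` is routed to the common root `v`, where the total arriving is `∑ b = 0`.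
  refine ⟨fun i j => ∑ u, b u * z u i j, IsFlow.sum fun u _ => (hz u).const_mul _, fun i => ?_⟩
  rw [Finset.sum_comm]
  simp only [← Finset.mul_sum, hdiv, mul_sub, Finset.sum_sub_distrib, ← Finset.sum_mul, hb]
  simp [Pi.single_apply]

end IsFlow

/-! ### Independence and averaging over activations. -/

/-- If `m₁` is independent of `m₂ ⊔ m₃` and `m₂` of `m₃`, then `m₁ ⊔ m₂` is independent of `m₃`. -/
theorem ProbabilityTheory.Indep.sup_left {Ω : Type*} {m₁ m₂ m₃ mΩ : MeasurableSpace Ω}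
    {P : Measure Ω} [IsProbabilityMeasure P] (h₁ : m₁ ≤ mΩ) (h₂ : m₂ ≤ mΩ) (h₃ : m₃ ≤ mΩ)
    (h : Indep m₁ (m₂ ⊔ m₃) P) (h' : Indep m₂ m₃ P) : Indep (m₁ ⊔ m₂) m₃ P := by
  have hle₂ : m₂ ≤ m₂ ⊔ m₃ := le_sup_left
  have hle₃ : m₃ ≤ m₂ ⊔ m₃ := le_sup_right
  -- The intersections `a ∩ b` form a π-system generating `m₁ ⊔ m₂`, so the product formula need
  -- only be checked on them.
  refine IndepSets.indep
    (p1 := Set.image2 (· ∩ ·) {s | MeasurableSet[m₁] s} {s | MeasurableSet[m₂] s})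
    (p2 := {s | MeasurableSet[m₃] s}) (sup_le h₁ h₂) h₃ ?_
    (@MeasurableSpace.isPiSystem_measurableSet _ m₃) ?_
    (@MeasurableSpace.generateFrom_measurableSet _ m₃).symm ?_
  · rintro _ ⟨a, ha, b, hb, rfl⟩ _ ⟨a', ha', b', hb', rfl⟩ -
    exact ⟨a ∩ a', MeasurableSet.inter ha ha', b ∩ b', MeasurableSet.inter hb hb',
      Set.inter_inter_inter_comm _ _ _ _⟩
  · refine le_antisymm (sup_le (fun s hs => ?_) fun s hs => ?_)
      (MeasurableSpace.generateFrom_le ?_)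
    · exact MeasurableSpace.measurableSet_generateFrom
        ⟨s, hs, Set.univ, @MeasurableSet.univ _ m₂, Set.inter_univ s⟩
    · exact MeasurableSpace.measurableSet_generateFrom
        ⟨Set.univ, @MeasurableSet.univ _ m₁, s, hs, Set.univ_inter s⟩
    · rintro _ ⟨a, ha, b, hb, rfl⟩
      have hl : m₁ ≤ m₁ ⊔ m₂ := le_sup_left
      have hr : m₂ ≤ m₁ ⊔ m₂ := le_sup_right
      exact MeasurableSet.inter (hl _ ha) (hr _ hb)
  · rw [IndepSets_iff]
    rintro _ c ⟨a, ha, b, hb, rfl⟩ hc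
    rw [Indep_iff] at h h'
    dsimp only
    rw [Set.inter_assoc, h a (b ∩ c) ha (MeasurableSet.inter (hle₂ _ hb) (hle₃ _ hc)),
      h' b c hb hc, h a b ha (hle₂ _ hb), mul_assoc]

section Activation

variable {N : ℕ} {G : SimpleGraph (Fin N)} {Ω : Type*} {𝒰 : MeasurableSpace Ω}
  [mΩ : MeasurableSpace Ω] {P : Measure Ω} {σ : G.edgeSet → ℝ} {ν : ℕ → G.edgeSet → Ω → Bool}

omit mΩ in
theorem comap_le_information {ι : Type*} {ν : ℕ → ι → Ω → Bool} {s t : ℕ} (h : s < t) (e : ι) :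
    MeasurableSpace.comap (ν s e) inferInstance ≤ information 𝒰 ν t :=
  le_sup_of_le_right (le_iSup_of_le s (le_iSup_of_le h (le_iSup_of_le e le_rfl)))

omit mΩ in
theorem information_mono {ι : Type*} {ν : ℕ → ι → Ω → Bool} {s t : ℕ} (h : s ≤ t) :
    information 𝒰 ν s ≤ information 𝒰 ν t :=
  sup_le le_sup_left (iSup_le fun _ => iSup_le fun hr => iSup_le fun e =>
    comap_le_information (hr.trans_le h) e)

theorem IsActivationModel.information_le (hν : IsActivationModel G P σ ν) (h𝒰 : 𝒰 ≤ mΩ) (t : ℕ) :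
    information 𝒰 ν t ≤ mΩ :=
  sup_le h𝒰 (iSup_le fun s => iSup_le fun _ => iSup_le fun e => (hν.measurable s e).comap_le)

/-- The activations at time `t` are independent of the information available at time `t`. -/
theorem IsActivationModel.indep_information [IsProbabilityMeasure P]
    (hν : IsActivationModel G P σ ν) (h𝒰 : 𝒰 ≤ mΩ) (hindep : Indep 𝒰 (activations ν) P)
    (t : ℕ) (e : G.edgeSet) :
    Indep (information 𝒰 ν t) (MeasurableSpace.comap (ν t e) inferInstance) P := by
  have hle : ∀ p : ℕ × G.edgeSet, MeasurableSpace.comap (ν p.1 p.2) inferInstance ≤ mΩ :=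
    fun p => (hν.measurable p.1 p.2).comap_le
  have hpast : Indep (⨆ (s : ℕ) (_ : s < t) (e : G.edgeSet),
      MeasurableSpace.comap (ν s e) inferInstance)
      (MeasurableSpace.comap (ν t e) inferInstance) P := by
    have h := indep_iSup_of_disjoint hle hν.indep.iIndep
      (S := {p | p.1 < t}) (T := {(t, e)}) (by simp)
    refine indep_of_indep_of_le h ?_ ?_
    · exact iSup_le fun s => iSup_le fun hs => iSup_le fun e' =>
        le_iSup₂_of_le (s, e') hs le_rfl
    · exact le_iSup₂_of_le (t, e) rfl le_rfl
  refine Indep.sup_left h𝒰 (iSup_le fun s => iSup_le fun _ => iSup_le fun e' => hle (s, e'))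
    (hle (t, e)) (indep_of_indep_of_le_right hindep (sup_le ?_ ?_)) hpast
  · exact iSup_le fun s => iSup_le fun _ => iSup_le fun e' =>
      le_iSup_of_le s (le_iSup_of_le e' le_rfl)
  · exact le_iSup_of_le t (le_iSup_of_le e le_rfl)

open Classical in
/-- The indicator that the edge between `i` and `j` is active. -/
def activity (G : SimpleGraph (Fin N)) (a : G.edgeSet → Bool) (i j : Fin N) : ℝ :=
  if (activeGraph G a).Adj i j then 1 else 0

theorem activity_comm (a : G.edgeSet → Bool) (i j : Fin N) :
    activity G a j i = activity G a i j := by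
  classical
  exact if_congr ((activeGraph G a).adj_comm j i) rfl rfl

theorem activity_of_not_adj (a : G.edgeSet → Bool) {i j : Fin N} (h : ¬ G.Adj i j) :
    activity G a i j = 0 :=
  if_neg fun ⟨h', _⟩ => h h'

theorem activity_of_adj (a : G.edgeSet → Bool) {i j : Fin N} (h : G.Adj i j) :
    activity G a i j = if a ⟨s(i, j), h⟩ = true then 1 else 0 := by
  classical
  refine if_congr ?_ rfl rfl
  exact ⟨fun ⟨_, ha⟩ => ha, fun ha => ⟨h, ha⟩⟩

theorem activity_mul_self (a : G.edgeSet → Bool) (i j : Fin N) :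
    activity G a i j * activity G a i j = activity G a i j := by
  unfold activity; split_ifs <;> simp

theorem activity_nonneg (a : G.edgeSet → Bool) (i j : Fin N) : 0 ≤ activity G a i j := by
  unfold activity; split_ifs <;> simp

theorem activity_le_one (a : G.edgeSet → Bool) (i j : Fin N) : activity G a i j ≤ 1 := by
  unfold activity; split_ifs <;> simp

/-- The inverse of the activation probability of the edge between `i` and `j`, and zero if there is
no such edge. -/
def edgeWeight (G : SimpleGraph (Fin N)) (σ : G.edgeSet → ℝ) (i j : Fin N) : ℝ :=
  open Classical in if h : G.Adj i j then (σ ⟨s(i, j), h⟩)⁻¹ else 0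

theorem edgeWeight_nonneg (hσ : ∀ e, 0 < σ e) (i j : Fin N) : 0 ≤ edgeWeight G σ i j := by
  unfold edgeWeight
  split_ifs with h
  · exact (inv_pos.mpr (hσ _)).le
  · exact le_rfl

omit mΩ in
theorem measurable_activity_of_comap_le {m' : MeasurableSpace Ω} {t : ℕ}
    (h : ∀ e, MeasurableSpace.comap (ν t e) inferInstance ≤ m') (i j : Fin N) :
    Measurable[m'] fun ω => activity G (fun e => ν t e ω) i j := by
  by_cases hij : G.Adj i j
  · simp only [activity_of_adj _ hij]
    have h1 : Measurable[m'] (ν t ⟨s(i, j), hij⟩) := measurable_iff_comap_le.mpr (h _)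
    exact (measurable_of_finite fun b : Bool => if b = true then (1 : ℝ) else 0).comp h1
  · simp only [activity_of_not_adj _ hij]
    exact measurable_const

/-- Averaging over the activation of an edge cancels its weight. -/
theorem IsActivationModel.weighted_integral_eq [IsProbabilityMeasure P]
    (hν : IsActivationModel G P σ ν) (h𝒰 : 𝒰 ≤ mΩ) (hindep : Indep 𝒰 (activations ν) P)
    {t : ℕ} {i j : Fin N} (hij : G.Adj i j) {h : Ω → ℝ} (hh : Measurable[information 𝒰 ν t] h) :
    edgeWeight G σ i j * ∫ ω, activity G (fun e => ν t e ω) i j * h ω ∂P = ∫ ω, h ω ∂P := by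
  set e : G.edgeSet := ⟨s(i, j), hij⟩
  set c : Bool → ℝ := fun b => if b = true then 1 else 0
  have hc : Measurable c := measurable_of_finite c
  have hνe : Measurable[MeasurableSpace.comap (ν t e) inferInstance] fun ω => c (ν t e ω) :=
    hc.comp (comap_measurable (ν t e))
  have hind : IndepFun (fun ω => c (ν t e ω)) h P := by
    rw [IndepFun_iff_Indep]
    exact indep_of_indep_of_le (hν.indep_information h𝒰 hindep t e).symm hνe.comap_le hh.comap_le
  have hmean : ∫ ω, c (ν t e ω) ∂P = σ e := by
    have h1 : (fun ω => c (ν t e ω)) = Set.indicator {ω | ν t e ω = true} 1 := by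
      ext ω
      simp [c, Set.indicator_apply]
    have h2 : MeasurableSet {ω | ν t e ω = true} :=
      hν.measurable t e (measurableSet_singleton true)
    rw [h1, integral_indicator_one h2, hν.prob_active]
  have hact : (fun ω => activity G (fun e => ν t e ω) i j * h ω) =
      fun ω => c (ν t e ω) * h ω := by
    ext ω
    rw [activity_of_adj _ hij]
  rw [hact, hind.integral_fun_mul_eq_mul_integral
      (hc.comp (hν.measurable t e)).aestronglyMeasurable
      (hh.mono (hν.information_le h𝒰 t) le_rfl).aestronglyMeasurable, hmean, edgeWeight,
    dif_pos hij, ← mul_assoc, inv_mul_cancel₀ (hν.σ_pos e).ne', one_mul]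

end Activation

/-- Nonnegative integrable random variables whose expectations are summable are almost surely
summable. -/
theorem ae_summable_of_sum_integral_le {Ω : Type*} [MeasurableSpace Ω] {P : Measure Ω}
    {f : ℕ → Ω → ℝ} (hf : ∀ t, Integrable (f t) P) (hf0 : ∀ t ω, 0 ≤ f t ω) {C : ℝ}
    (hC : ∀ T, ∑ t ∈ Finset.range T, ∫ ω, f t ω ∂P ≤ C) :
    ∀ᵐ ω ∂P, Summable fun t => f t ω := by
  have hs : Summable fun t => ∫ ω, f t ω ∂P :=
    summable_of_sum_range_le (fun t => integral_nonneg (hf0 t)) hC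
  have hfin : ∫⁻ ω, ∑' t, ENNReal.ofReal (f t ω) ∂P ≠ ⊤ := by
    rw [lintegral_tsum fun t => (hf t).aemeasurable.ennreal_ofReal]
    simp only [← ofReal_integral_eq_lintegral_ofReal (hf _) (ae_of_all _ (hf0 _))]
    exact hs.tsum_ofReal_ne_top
  filter_upwards [ae_lt_top' (AEMeasurable.tsum
    fun t => (hf t).aemeasurable.ennreal_ofReal) hfin] with ω hω
  simpa only [ENNReal.toReal_ofReal (hf0 _ ω)] using ENNReal.summable_toReal hω.ne

/-! ### The flow accumulated along the edges and its energy in expectation. -/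

section EdgeFlow

variable {N S : ℕ} {G : SimpleGraph (Fin N)} {M : ℝ} {α : ℕ → ℝ} {a : ℕ → G.edgeSet → Bool}
  {m : ℕ → Fin N → Fin S → ℝ}

/-- The amount of resource `s` exchanged along the edges before time `t`. -/
def edgeFlow (G : SimpleGraph (Fin N)) (α : ℕ → ℝ) (a : ℕ → G.edgeSet → Bool)
    (m : ℕ → Fin N → Fin S → ℝ) (t : ℕ) (s : Fin S) (i j : Fin N) : ℝ :=
  ∑ r ∈ Finset.range t, α r * (activity G (a r) i j * (m r i s - m r j s))

theorem edgeFlow_succ (t : ℕ) (s : Fin S) (i j : Fin N) :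
    edgeFlow G α a m (t + 1) s i j =
      edgeFlow G α a m t s i j + α t * (activity G (a t) i j * (m t i s - m t j s)) :=
  Finset.sum_range_succ _ _

theorem isFlow_edgeFlow (t : ℕ) (s : Fin S) : IsFlow G (edgeFlow G α a m t s) := by
  refine IsFlow.sum fun r _ => IsFlow.const_mul ⟨fun i j => ?_, fun i j hij => ?_⟩ _
  · rw [activity_comm]; ring
  · rw [activity_of_not_adj _ hij, zero_mul]

theorem abs_activity_mul_sub_le (hm0 : ∀ t i s, 0 ≤ m t i s) (hmM : ∀ t i s, m t i s ≤ M)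
    (t : ℕ) (s : Fin S) (i j : Fin N) : |activity G (a t) i j * (m t i s - m t j s)| ≤ M := by
  have h1 : |m t i s - m t j s| ≤ M :=
    abs_le.mpr ⟨by linarith [hm0 t i s, hmM t j s], by linarith [hm0 t j s, hmM t i s]⟩
  rw [abs_mul, abs_of_nonneg (activity_nonneg _ _ _)]
  calc _ ≤ 1 * |m t i s - m t j s| :=
        mul_le_mul_of_nonneg_right (activity_le_one _ _ _) (abs_nonneg _)
    _ ≤ M := by rwa [one_mul]

theorem abs_edgeFlow_le (hα : ∀ t, 0 ≤ α t) (hm0 : ∀ t i s, 0 ≤ m t i s)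
    (hmM : ∀ t i s, m t i s ≤ M) (t : ℕ) (s : Fin S) (i j : Fin N) :
    |edgeFlow G α a m t s i j| ≤ ∑ r ∈ Finset.range t, α r * M := by
  refine (Finset.abs_sum_le_sum_abs _ _).trans (Finset.sum_le_sum fun r _ => ?_)
  rw [abs_mul, abs_of_nonneg (hα r)]
  exact mul_le_mul_of_nonneg_left (abs_activity_mul_sub_le hm0 hmM r s i j) (hα r)

end EdgeFlow

section Expectation

variable {N S : ℕ} {G : SimpleGraph (Fin N)} {Ω : Type*} {𝒰 : MeasurableSpace Ω}
  [mΩ : MeasurableSpace Ω] {P : Measure Ω} {σ : G.edgeSet → ℝ} {ν : ℕ → G.edgeSet → Ω → Bool}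
  {α : ℕ → ℝ} {M : ℝ} {m : ℕ → Ω → Fin N → Fin S → ℝ}

omit mΩ in
theorem measurable_multiplier (hm : ∀ t, Measurable[information 𝒰 ν t] (m t)) {r t : ℕ}
    (h : r ≤ t) (i : Fin N) (s : Fin S) : Measurable[information 𝒰 ν t] fun ω => m r ω i s :=
  (measurable_pi_apply s).comp
    ((measurable_pi_apply i).comp ((hm r).mono (information_mono h) le_rfl))

omit mΩ in
-- Only terms with `r < t` enter, so the flow at time `t` does not see the activations at time `t`;
-- this permits averaging over them.
theorem measurable_edgeFlow (hm : ∀ t, Measurable[information 𝒰 ν t] (m t)) (t : ℕ) (s : Fin S)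
    (i j : Fin N) : Measurable[information 𝒰 ν t] fun ω =>
      edgeFlow G α (fun t e => ν t e ω) (fun t => m t ω) t s i j := by
  unfold edgeFlow
  refine Finset.measurable_sum _ fun r hr => ?_
  have hrt := Finset.mem_range.mp hr
  exact ((measurable_activity_of_comap_le (fun e => comap_le_information hrt e) i j).mul
    ((measurable_multiplier hm hrt.le i s).sub (measurable_multiplier hm hrt.le j s))).const_mul _

/-- One step of the weighted energy of a single edge, in expectation. -/
theorem IsActivationModel.integral_energy_le [IsProbabilityMeasure P]
    (hν : IsActivationModel G P σ ν) (h𝒰 : 𝒰 ≤ mΩ) (hindep : Indep 𝒰 (activations ν) P)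
    {t : ℕ} {i j : Fin N} {u δ : Ω → ℝ} (hu : Measurable[information 𝒰 ν t] u)
    (hδ : Measurable[information 𝒰 ν t] δ) {B : ℝ} (huB : ∀ ω, |u ω| ≤ B) (hδM : ∀ ω, |δ ω| ≤ M)
    (hadj : ¬ G.Adj i j → ∀ ω, u ω = 0) (c : ℝ) :
    edgeWeight G σ i j *
        ∫ ω, (u ω + c * (activity G (fun e => ν t e ω) i j * δ ω)) ^ 2 ∂P ≤
      edgeWeight G σ i j * ∫ ω, u ω ^ 2 ∂P + 2 * c * ∫ ω, u ω * δ ω ∂P +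
        c ^ 2 * (edgeWeight G σ i j * M ^ 2) := by
  by_cases hij : G.Adj i j
  swap
  -- The cross term on the right carries no weight, so off the edges it vanishes only because `u`
  -- does.
  · simp [edgeWeight, hij, hadj hij]
  have hle := hν.information_le h𝒰 t
  have hu' : Measurable u := hu.mono hle le_rfl
  have hδ' : Measurable δ := hδ.mono hle le_rfl
  have hact : Measurable fun ω => activity G (fun e => ν t e ω) i j :=
    measurable_activity_of_comap_le (fun e => (hν.measurable t e).comap_le) i j
  obtain ⟨ω₀⟩ := P.nonempty_of_neZero
  have hB : 0 ≤ B := (abs_nonneg _).trans (huB ω₀)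
  have hM : 0 ≤ M := (abs_nonneg _).trans (hδM ω₀)
  have hactle : ∀ ω (v : ℝ), |activity G (fun e => ν t e ω) i j * v| ≤ |v| := fun ω v => by
    rw [abs_mul, abs_of_nonneg (activity_nonneg _ _ _)]
    exact mul_le_of_le_one_left (abs_nonneg v) (activity_le_one _ _ _)
  have hi1 : Integrable (fun ω => u ω ^ 2) P :=
    Integrable.of_bound (hu'.pow_const 2).aestronglyMeasurable (B ^ 2) (ae_of_all _ fun ω => by
      rw [Real.norm_eq_abs, abs_pow]
      exact pow_le_pow_left₀ (abs_nonneg _) (huB ω) 2)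
  have hi2 : Integrable (fun ω => activity G (fun e => ν t e ω) i j * (u ω * δ ω)) P :=
    Integrable.of_bound (hact.mul (hu'.mul hδ')).aestronglyMeasurable (B * M)
      (ae_of_all _ fun ω => (hactle ω _).trans (by
        rw [abs_mul]
        exact mul_le_mul (huB ω) (hδM ω) (abs_nonneg _) hB))
  have hδ2 : ∀ ω, |δ ω ^ 2| ≤ M ^ 2 := fun ω => by
    rw [abs_pow]
    exact pow_le_pow_left₀ (abs_nonneg _) (hδM ω) 2
  have hi3 : Integrable (fun ω => activity G (fun e => ν t e ω) i j * δ ω ^ 2) P :=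
    Integrable.of_bound (hact.mul (hδ'.pow_const 2)).aestronglyMeasurable (M ^ 2)
      (ae_of_all _ fun ω => (hactle ω _).trans (hδ2 ω))
  -- The activity is idempotent, so the square is affine in it.
  have hexp : (fun ω => (u ω + c * (activity G (fun e => ν t e ω) i j * δ ω)) ^ 2) =
      fun ω => u ω ^ 2 + 2 * c * (activity G (fun e => ν t e ω) i j * (u ω * δ ω)) +
        c ^ 2 * (activity G (fun e => ν t e ω) i j * δ ω ^ 2) := by
    ext ω
    linear_combination c ^ 2 * δ ω ^ 2 * activity_mul_self (fun e => ν t e ω) i j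
  have hlast : ∫ ω, activity G (fun e => ν t e ω) i j * δ ω ^ 2 ∂P ≤ M ^ 2 := by
    have h1 := integral_mono hi3 (integrable_const (M ^ 2))
      fun ω => (le_abs_self _).trans ((hactle ω _).trans (hδ2 ω))
    simpa using h1
  -- The product `u * δ` is known before the activation, so the weight removes the activity from the
  -- cross term exactly.
  have hmid := hν.weighted_integral_eq h𝒰 hindep hij (hu.mul hδ)
  have hmid' : edgeWeight G σ i j *
      ∫ ω, activity G (fun e => ν t e ω) i j * (u ω * δ ω) ∂P = ∫ ω, u ω * δ ω ∂P := hmid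
  have hi12 : Integrable (fun ω =>
      u ω ^ 2 + 2 * c * (activity G (fun e => ν t e ω) i j * (u ω * δ ω))) P :=
    hi1.add (hi2.const_mul _)
  rw [hexp, integral_add hi12 (hi3.const_mul _),
    integral_add hi1 (hi2.const_mul _), integral_const_mul, integral_const_mul]
  have hw := mul_le_mul_of_nonneg_left
    (mul_le_mul_of_nonneg_left hlast (edgeWeight_nonneg hν.σ_pos i j)) (sq_nonneg c)
  linear_combination hw + 2 * c * hmid'

/-- The pairing of the multipliers with the distance of the current flow to a reference flow is
almost surely summable against the step-sizes, provided that it is nonnegative. -/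
theorem IsActivationModel.ae_summable_pairing [IsProbabilityMeasure P]
    (hν : IsActivationModel G P σ ν) (h𝒰 : 𝒰 ≤ mΩ) (hindep : Indep 𝒰 (activations ν) P)
    (hα : IsStepSize α) (hm : ∀ t, Measurable[information 𝒰 ν t] (m t))
    (hm0 : ∀ ω t i s, 0 ≤ m t ω i s) (hmM : ∀ ω t i s, m t ω i s ≤ M)
    {zs : Fin S → Fin N → Fin N → ℝ} (hzs : ∀ s, IsFlow G (zs s)) {d : ℕ → Ω → ℝ}
    (hd : ∀ t ω, d t ω = ∑ s, ∑ i, m t ω i s *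
      ∑ j, (zs s i j - edgeFlow G α (fun t e => ν t e ω) (fun t => m t ω) t s i j))
    (hd0 : ∀ t ω, 0 ≤ d t ω) : ∀ᵐ ω ∂P, Summable fun t => α t * d t ω := by
  set u : ℕ → Ω → Fin S → Fin N → Fin N → ℝ := fun t ω s i j =>
    edgeFlow G α (fun t e => ν t e ω) (fun t => m t ω) t s i j - zs s i j with hu
  have hum : ∀ t s i j, Measurable[information 𝒰 ν t] fun ω => u t ω s i j := fun t s i j =>
    (measurable_edgeFlow hm t s i j).sub_const _
  have huB : ∀ t s i j ω, |u t ω s i j| ≤ ∑ r ∈ Finset.range t, α r * M + |zs s i j| :=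
    fun t s i j ω => (abs_sub _ _).trans
      (add_le_add_left (abs_edgeFlow_le hα.nonneg (hm0 ω) (hmM ω) t s i j) _)
  have hflow : ∀ t ω s, IsFlow G (u t ω s) := fun t ω s => (isFlow_edgeFlow t s).sub (hzs s)
  have hδ : ∀ t s i j, Measurable[information 𝒰 ν t] fun ω => m t ω i s - m t ω j s :=
    fun t s i j => (measurable_multiplier hm le_rfl i s).sub (measurable_multiplier hm le_rfl j s)
  have hδM : ∀ t s i j ω, |m t ω i s - m t ω j s| ≤ M := fun t s i j ω =>
    abs_le.mpr ⟨by linarith [hm0 ω t i s, hmM ω t j s], by linarith [hm0 ω t j s, hmM ω t i s]⟩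
  -- Summation by parts: the 2 comes from counting each edge in both directions, the sign from `u`
  -- being current minus reference flow.
  have hsum : ∀ t ω, ∑ s, ∑ i, ∑ j, u t ω s i j * (m t ω i s - m t ω j s) = -2 * d t ω := by
    intro t ω
    simp only [(hflow t ω _).sum_mul_sub fun i => m t ω i _]
    rw [hd, Finset.mul_sum]
    refine Finset.sum_congr rfl fun s _ => ?_
    have h1 : ∀ i, ∑ j, u t ω s i j =
        -∑ j, (zs s i j - edgeFlow G α (fun t e => ν t e ω) (fun t => m t ω) t s i j) := by
      intro i
      rw [← Finset.sum_neg_distrib]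
      exact Finset.sum_congr rfl fun j _ => by simp only [hu]; ring
    simp only [h1, mul_neg, Finset.sum_neg_distrib]
    ring
  have hint : ∀ t s i j, Integrable (fun ω => u t ω s i j * (m t ω i s - m t ω j s)) P := by
    intro t s i j
    refine Integrable.of_bound (((hum t s i j).mul (hδ t s i j)).mono
      (hν.information_le h𝒰 t) le_rfl).aestronglyMeasurable
      ((∑ r ∈ Finset.range t, α r * M + |zs s i j|) * M) (ae_of_all _ fun ω => ?_)
    rw [Real.norm_eq_abs, abs_mul]
    exact mul_le_mul (huB t s i j ω) (hδM t s i j ω) (abs_nonneg _)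
      ((abs_nonneg _).trans (huB t s i j ω))
  have hdint : ∀ t, Integrable (d t) P := by
    intro t
    have h1 : Integrable
        (fun ω => ∑ s, ∑ i, ∑ j, u t ω s i j * (m t ω i s - m t ω j s)) P :=
      integrable_finsetSum _ fun s _ => integrable_finsetSum _ fun i _ =>
        integrable_finsetSum _ fun j _ => hint t s i j
    have h2 : d t =
        fun ω => (-2)⁻¹ * ∑ s, ∑ i, ∑ j, u t ω s i j * (m t ω i s - m t ω j s) := by
      ext ω
      rw [hsum]; ring
    rw [h2]
    exact h1.const_mul _
  have hdsum : ∀ t, ∑ s, ∑ i, ∑ j, ∫ ω, u t ω s i j * (m t ω i s - m t ω j s) ∂P =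
      -2 * ∫ ω, d t ω ∂P := by
    intro t
    rw [← integral_const_mul, integral_congr_ae (ae_of_all _ fun ω => (hsum t ω).symm),
      integral_finsetSum _ fun s _ => integrable_finsetSum _ fun i _ =>
        integrable_finsetSum _ fun j _ => hint t s i j]
    refine Finset.sum_congr rfl fun s _ => ?_
    rw [integral_finsetSum _ fun i _ => integrable_finsetSum _ fun j _ => hint t s i j]
    refine Finset.sum_congr rfl fun i _ => ?_
    rw [integral_finsetSum _ fun j _ => hint t s i j]
  set EV : ℕ → ℝ := fun t => ∑ s, ∑ i, ∑ j, edgeWeight G σ i j * ∫ ω, u t ω s i j ^ 2 ∂P with hEV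
  set C : ℝ := ∑ _s : Fin S, ∑ i, ∑ j, edgeWeight G σ i j * M ^ 2 with hC
  have hC0 : 0 ≤ C := Finset.sum_nonneg fun _ _ => Finset.sum_nonneg fun i _ =>
    Finset.sum_nonneg fun j _ => mul_nonneg (edgeWeight_nonneg hν.σ_pos i j) (sq_nonneg M)
  have hEV0 : ∀ t, 0 ≤ EV t := fun t => Finset.sum_nonneg fun _ _ => Finset.sum_nonneg fun i _ =>
    Finset.sum_nonneg fun j _ => mul_nonneg (edgeWeight_nonneg hν.σ_pos i j)
      (integral_nonneg fun ω => sq_nonneg _)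
  have hstep : ∀ t, EV (t + 1) ≤ EV t + 2 * α t * (-2 * ∫ ω, d t ω ∂P) + α t ^ 2 * C := by
    intro t
    rw [← hdsum]
    simp only [hEV, hC, Finset.mul_sum, ← Finset.sum_add_distrib]
    refine Finset.sum_le_sum fun s _ => Finset.sum_le_sum fun i _ =>
      Finset.sum_le_sum fun j _ => ?_
    have h1 := hν.integral_energy_le h𝒰 hindep (i := i) (j := j) (hum t s i j) (hδ t s i j)
      (huB t s i j) (hδM t s i j) (fun hij ω => (hflow t ω s).support i j hij) (α t)
    have h2 : ∀ ω, u (t + 1) ω s i j =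
        u t ω s i j + α t * (activity G (fun e => ν t e ω) i j * (m t ω i s - m t ω j s)) := by
      intro ω
      simp only [hu, edgeFlow_succ]
      ring
    simpa only [h2] using h1
  -- The 4 combines the 2 of the expanded square with the 2 of the summation by parts.
  refine ae_summable_of_sum_integral_le (C := (EV 0 + C * ∑' t, α t ^ 2) / 4)
    (fun t => (hdint t).const_mul _) (fun t ω => mul_nonneg (hα.nonneg t) (hd0 t ω)) fun T => ?_
  have hind : ∀ T, EV T + 4 * ∑ t ∈ Finset.range T, ∫ ω, α t * d t ω ∂P ≤
      EV 0 + C * ∑ t ∈ Finset.range T, α t ^ 2 := by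
    intro T
    induction T with
    | zero => simp
    | succ T ih =>
      rw [Finset.sum_range_succ, Finset.sum_range_succ, integral_const_mul]
      linarith [hstep T]
  have h3 := hα.sum_sq_lt_top.sum_le_tsum (Finset.range T) fun t _ => sq_nonneg (α t)
  have h4 := mul_le_mul_of_nonneg_left h3 hC0
  linarith [hind T, hEV0 T]

end Expectation

/-! ### Deterministic properties of trajectories. -/

section Trajectory

variable {N S : ℕ} {D : CoupledData N S} {G : SimpleGraph (Fin N)} {M : ℝ} {α : ℕ → ℝ}
  {y0 : Fin N → Fin S → ℝ} {a : ℕ → G.edgeSet → Bool} {x : ℕ → (i : Fin N) → D.Var i}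
  {ρ : ℕ → Fin N → ℝ} {m y : ℕ → Fin N → Fin S → ℝ}

namespace IsGenerated

theorem update_apply (h : IsGenerated D G M α y0 a x ρ m y) (t : ℕ) (i : Fin N) (s : Fin S) :
    y (t + 1) i s = y t i s + α t * ∑ j, activity G (a t) i j * (m t i s - m t j s) := by
  classical
  rw [h.update t i, Pi.add_apply, Pi.smul_apply, Finset.sum_apply, Finset.sum_filter, smul_eq_mul]
  congr 2
  refine Finset.sum_congr rfl fun j _ => ?_
  unfold activity
  split_ifs <;> simp

/-- This moves the analysis to flow variables, where each edge has its own coordinate and can be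
weighted by its own activation probability. -/
theorem eq_add_sum_edgeFlow (h : IsGenerated D G M α y0 a x ρ m y) (t : ℕ) (i : Fin N)
    (s : Fin S) : y t i s = y0 i s + ∑ j, edgeFlow G α a m t s i j := by
  induction t with
  | zero => simp [h.init, edgeFlow]
  | succ t ih =>
    simp only [h.update_apply, ih, edgeFlow_succ, Finset.sum_add_distrib, ← Finset.mul_sum]
    ring

theorem sum_eq_zero (h : IsGenerated D G M α y0 a x ρ m y) (hy0 : ∑ i, y0 i = 0) (t : ℕ) :
    ∑ i, y t i = 0 := by
  ext s
  have h0 : ∑ i, y0 i s = 0 := by simpa using congrFun hy0 s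
  simp only [Finset.sum_apply, h.eq_add_sum_edgeFlow, Finset.sum_add_distrib, h0,
    (isFlow_edgeFlow t s).sum_sum_eq_zero, Pi.zero_apply, add_zero]

theorem multiplier_nonneg (h : IsGenerated D G M α y0 a x ρ m y) (t : ℕ) (i : Fin N) (s : Fin S) :
    0 ≤ m t i s :=
  (h.solve t i).2.1 s

theorem multiplier_le (h : IsGenerated D G M α y0 a x ρ m y) (t : ℕ) (i : Fin N) (s : Fin S) :
    m t i s ≤ M :=
  CoupledData.multiplier_le (h.solve t i) s

theorem feasible (h : IsGenerated D G M α y0 a x ρ m y) (t : ℕ) (i : Fin N) :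
    (x t i, ρ t i) ∈ (D.localProblem M i (y t i)).feasible :=
  (h.solve t i).1.1

theorem relaxation_nonneg (h : IsGenerated D G M α y0 a x ρ m y) (t : ℕ) (i : Fin N) :
    0 ≤ ρ t i :=
  (h.feasible t i).1.2

/-- The penalized costs vary at most proportionally to the step-sizes. -/
theorem abs_sub_le (h : IsGenerated D G M α y0 a x ρ m y) (hα : ∀ t, 0 ≤ α t) (hM : 0 ≤ M)
    (t : ℕ) : |∑ i, (D.f i (x (t + 1) i) + M * ρ (t + 1) i) - ∑ i, (D.f i (x t i) + M * ρ t i)| ≤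
      (N * (S * (M * (N * M)))) * α t := by
  have hdiff : ∀ i s, |y (t + 1) i s - y t i s| ≤ α t * (N * M) := by
    intro i s
    rw [h.update_apply, add_sub_cancel_left, abs_mul, abs_of_nonneg (hα t)]
    refine mul_le_mul_of_nonneg_left ((Finset.abs_sum_le_sum_abs _ _).trans ?_) (hα t)
    refine (Finset.sum_le_sum fun j _ =>
      abs_activity_mul_sub_le h.multiplier_nonneg h.multiplier_le t s i j).trans ?_
    simp
  have hpair : ∀ r, ∀ v : Fin N → Fin S → ℝ, (∀ i s, |v i s| ≤ α t * (N * M)) →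
      -((N * (S * (M * (N * M)))) * α t) ≤ ∑ i, ∑ s, m r i s * v i s := by
    intro r v hv
    have h1 : ∑ _i : Fin N, ∑ _s : Fin S, -(M * (α t * (N * M))) ≤ ∑ i, ∑ s, m r i s * v i s := by
      refine Finset.sum_le_sum fun i _ => Finset.sum_le_sum fun s _ => ?_
      refine (abs_le.mp ?_).1
      rw [abs_mul, abs_of_nonneg (h.multiplier_nonneg r i s)]
      exact mul_le_mul (h.multiplier_le r i s) (hv i s) (abs_nonneg _) hM
    refine le_trans (le_of_eq ?_) h1
    simp only [Finset.sum_const, Finset.card_univ, Fintype.card_fin, nsmul_eq_mul]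
    ring
  -- The subgradient inequality, used at both times, bounds the change of the cost from either side.
  have h1 := Finset.sum_le_sum fun i (_ : i ∈ Finset.univ) =>
    CoupledData.cost_add_le (h.solve (t + 1) i) (h.feasible t i)
  have h2 := Finset.sum_le_sum fun i (_ : i ∈ Finset.univ) =>
    CoupledData.cost_add_le (h.solve t i) (h.feasible (t + 1) i)
  rw [Finset.sum_add_distrib] at h1 h2
  have h3 := hpair (t + 1) (fun i s => y (t + 1) i s - y t i s) hdiff
  have h4 := hpair t (fun i s => y t i s - y (t + 1) i s) fun i s => by
    rw [abs_sub_comm]; exact hdiff i s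
  exact abs_le.mpr ⟨by linarith, by linarith⟩

/-- The suboptimality of the penalized costs is bounded by the pairing of the multipliers with the
distance to an optimal allocation. -/
theorem sub_le_pairing (h : IsGenerated D G M α y0 a x ρ m y) {xs : (i : Fin N) → D.Var i}
    {ys : Fin N → Fin S → ℝ} (hxs : ∀ i, (xs i, (0 : ℝ)) ∈ (D.localProblem M i (ys i)).feasible)
    (t : ℕ) : ∑ i, (D.f i (x t i) + M * ρ t i) - D.coupled.cost xs ≤
      ∑ s, ∑ i, m t i s * (ys i s - y t i s) := by
  have h1 := Finset.sum_le_sum fun i (_ : i ∈ Finset.univ) =>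
    CoupledData.cost_add_le (h.solve t i) (hxs i)
  simp only [mul_zero, add_zero] at h1
  rw [Finset.sum_add_distrib] at h1
  have h2 : ∑ s, ∑ i, m t i s * (ys i s - y t i s) =
      -∑ i, ∑ s, m t i s * (y t i s - ys i s) := by
    rw [Finset.sum_comm, ← Finset.sum_neg_distrib]
    refine Finset.sum_congr rfl fun i _ => ?_
    rw [← Finset.sum_neg_distrib]
    exact Finset.sum_congr rfl fun s _ => by ring
  have h3 : D.coupled.cost xs = ∑ i, D.f i (xs i) := rfl
  linarith

/-- If the penalized costs converge to the optimal cost, every limit point is optimal. -/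
theorem isOptimal_of_mapClusterPt (h : IsGenerated D G M α y0 a x ρ m y) (hD : D.IsConvexCompact)
    (hy0 : ∑ i, y0 i = 0) {mstar : Fin S → ℝ} (hmstar : D.coupled.IsLagrangeMultiplier mstar)
    (hM : ∑ s, mstar s < M) {xs : (i : Fin N) → D.Var i} (hxs : D.coupled.IsOptimal xs)
    (hlim : Tendsto (fun t => ∑ i, (D.f i (x t i) + M * ρ t i)) atTop
      (𝓝 D.coupled.optimalCost))
    {z : (i : Fin N) → D.Var i} (hz : MapClusterPt z atTop x) : D.coupled.IsOptimal z := by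
  have hgap : 0 < M - ∑ s, mstar s := sub_pos.mpr hM
  -- The strict inequality `‖mstar‖₁ < M` lets the vanishing gap control the relaxation.
  have hρ : Tendsto (fun t => ∑ i, ρ t i) atTop (𝓝 0) := by
    have h1 : Tendsto (fun t => (∑ i, (D.f i (x t i) + M * ρ t i) - D.coupled.optimalCost) /
        (M - ∑ s, mstar s)) atTop (𝓝 0) := by
      simpa using (hlim.sub_const D.coupled.optimalCost).div_const (M - ∑ s, mstar s)
    refine squeeze_zero (fun t => Finset.sum_nonneg fun i _ => h.relaxation_nonneg t i)
      (fun t => ?_) h1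
    rw [le_div_iff₀ hgap]
    linarith [CoupledData.optimalCost_add_le hmstar (h.sum_eq_zero hy0 t) (h.feasible t)]
  have hcost : Tendsto (fun t => D.coupled.cost (x t)) atTop (𝓝 D.coupled.optimalCost) := by
    have h1 := hlim.sub (hρ.const_mul M)
    rw [mul_zero, sub_zero] at h1
    refine h1.congr fun t => ?_
    rw [Finset.sum_add_distrib, ← Finset.mul_sum, add_sub_cancel_right]
    rfl
  obtain ⟨φ, hφ, hφz⟩ := hz.tendsto_subseq
  have hzcost : D.coupled.cost z = D.coupled.optimalCost :=
    tendsto_nhds_unique ((hD.continuous_cost.tendsto z).comp hφz) (hcost.comp hφ.tendsto_atTop)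
  refine ⟨⟨fun i => ?_, fun s => ?_⟩, fun w hw => ?_⟩
  · exact (hD.X_compact i).isClosed.mem_of_tendsto (((continuous_apply i).tendsto z).comp hφz)
      (Eventually.of_forall fun k => (h.feasible (φ k) i).1.1)
  · refine le_of_tendsto_of_tendsto' (((hD.continuous_constr s).tendsto z).comp hφz)
      (hρ.comp hφ.tendsto_atTop) fun k => ?_
    exact CoupledData.constr_le_sum (h.sum_eq_zero hy0 (φ k)) (h.feasible (φ k)) s
  · rw [hzcost, hxs.optimalCost_eq]
    exact hxs.2 w hw

end IsGenerated

end Trajectory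

end

/-! ### Almost sure convergence. -/

theorem theorem1 {N S : ℕ} (D : CoupledData N S)
    (hD : D.IsConvexCompact) (hSlater : D.Slater)
    (G : SimpleGraph (Fin N)) (hG : G.Connected)
    {Ω : Type*} (𝒰 : MeasurableSpace Ω) [mΩ : MeasurableSpace Ω]
    (P : Measure Ω) [IsProbabilityMeasure P]
    (σ : G.edgeSet → ℝ) (ν : ℕ → G.edgeSet → Ω → Bool) (hν : IsActivationModel G P σ ν)
    (h𝒰 : 𝒰 ≤ mΩ) (hindep : Indep 𝒰 (activations ν) P)
    (α : ℕ → ℝ) (hα : IsStepSize α)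
    (mstar : Fin S → ℝ) (hmstar : D.coupled.IsLagrangeMultiplier mstar)
    (M : ℝ) (hM : ∑ s, |mstar s| < M)
    (y0 : Fin N → Fin S → ℝ) (hy0 : ∑ i, y0 i = 0)
    (x : ℕ → Ω → (i : Fin N) → D.Var i) (ρ : ℕ → Ω → Fin N → ℝ)
    (m y : ℕ → Ω → Fin N → Fin S → ℝ)
    (hm : ∀ t, Measurable[information 𝒰 ν t] (m t))
    (hgen : ∀ ω, IsGenerated D G M α y0 (fun t e => ν t e ω)
      (fun t => x t ω) (fun t => ρ t ω) (fun t => m t ω) (fun t => y t ω)) :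
    ∀ᵐ ω ∂P,
      Tendsto (fun t => ∑ i, (D.f i (x t ω i) + M * ρ t ω i)) atTop (𝓝 D.coupled.optimalCost) ∧
      ∀ z : (i : Fin N) → D.Var i,
        MapClusterPt z atTop (fun t => x t ω) → D.coupled.IsOptimal z := by
  have hM' : ∑ s, mstar s < M :=
    (Finset.sum_le_sum fun s _ => le_abs_self (mstar s)).trans_lt hM
  have hM0 : 0 ≤ M := (Finset.sum_nonneg fun s _ => abs_nonneg (mstar s)).trans hM.le
  obtain ⟨i₀⟩ := hG.nonempty
  have : NeZero N := ⟨i₀.pos.ne'⟩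
  obtain ⟨xs, hxs⟩ := hD.exists_isOptimal hSlater
  obtain ⟨ys, hys0, hys⟩ := CoupledData.exists_allocation (M := M) hxs.1
  -- The reference flow, carrying the initial allocation to an optimal one.
  have hzs : ∀ s, ∃ z, IsFlow G z ∧ ∀ i, ∑ j, z i j = ys i s - y0 i s := fun s => by
    refine IsFlow.exists_of_sum_eq_zero hG ?_
    have h1 : ∑ i, ys i s = 0 := by simpa using congrFun hys0 s
    have h2 : ∑ i, y0 i s = 0 := by simpa using congrFun hy0 s
    rw [Finset.sum_sub_distrib, h1, h2, sub_zero]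
  choose zs hzs hdiv using hzs
  have hgap : ∀ t ω, 0 ≤ ∑ i, (D.f i (x t ω i) + M * ρ t ω i) - D.coupled.optimalCost := by
    intro t ω
    have h1 := CoupledData.optimalCost_add_le hmstar ((hgen ω).sum_eq_zero hy0 t)
      ((hgen ω).feasible t)
    have h2 : 0 ≤ (M - ∑ s, mstar s) * ∑ i, ρ t ω i := mul_nonneg (sub_nonneg.mpr hM'.le)
      (Finset.sum_nonneg fun i _ => (hgen ω).relaxation_nonneg t i)
    linarith
  have hle : ∀ t ω, ∑ i, (D.f i (x t ω i) + M * ρ t ω i) - D.coupled.optimalCost ≤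
      ∑ s, ∑ i, m t ω i s * (ys i s - y t ω i s) := fun t ω => by
    rw [hxs.optimalCost_eq]
    exact (hgen ω).sub_le_pairing hys t
  -- The pairing is integrated instead of the gap: it is built from the multipliers, whereas `x` and
  -- `ρ` may be chosen non-measurably.
  have hsum := hν.ae_summable_pairing h𝒰 hindep hα hm (fun ω => (hgen ω).multiplier_nonneg)
    (fun ω => (hgen ω).multiplier_le) hzs
    (d := fun t ω => ∑ s, ∑ i, m t ω i s * (ys i s - y t ω i s))
    (fun t ω => Finset.sum_congr rfl fun s _ => Finset.sum_congr rfl fun i _ => by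
      rw [Finset.sum_sub_distrib, hdiv, (hgen ω).eq_add_sum_edgeFlow]
      ring)
    (fun t ω => (hgap t ω).trans (hle t ω))
  filter_upwards [hsum] with ω hω
  have hsum' : Summable fun t =>
      α t * (∑ i, (D.f i (x t ω i) + M * ρ t ω i) - D.coupled.optimalCost) :=
    Summable.of_nonneg_of_le (fun t => mul_nonneg (hα.nonneg t) (hgap t ω))
      (fun t => mul_le_mul_of_nonneg_left (hle t ω) (hα.nonneg t)) hω
  have hzero := hα.tendsto_zero (fun t => hgap t ω) hsum' fun t => by
    rw [sub_sub_sub_cancel_right]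
    exact (hgen ω).abs_sub_le hα.nonneg hM0 t
  have hlim := tendsto_sub_nhds_zero_iff.mp hzero
  exact ⟨hlim, fun z hz =>
    (hgen ω).isOptimal_of_mapClusterPt hD hy0 hmstar hM' hxs hlim hz⟩
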